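/- For finite sets $Q, R \subset \mathbb{R}$ and real $t > 0$ put $$\mathrm{Sym}_t^+(Q,R) = \{x \in \mathbb{R} : |Q \cap (x - R)| \ge t\},$$ and for a nonempty finite set $A \subset \mathbb{R}$ put $$d_+(A) = \min \frac{|Q|^2 |R|^2}{|A|\, t^3},$$ where the minimum is taken over all real $t > 0$ and all nonempty finite sets $Q, R \subset \mathbb{R} \setminus \{0\}$ such that $A \subseteq \mathrm{Sym}_t^+(Q,R)$ and $\max\{|Q|,|R|\} \ge |A|$. (For $A = \emptyset$ put $d_+(A) = 0$.) Write $AB^{-1} = \{a/b : a \in A,\ b \in B,\ b \ne 0\}$. Then there is an absolute constant $C > 0$ such that for all finite sets $A, B \subset \mathbb{R}$ and every real number $\tau \ge 1$, $$\bigl|\{s \in AB^{-1} : |A \cap sB| \ge \tau\}\bigr| \le C\, \frac{d_+(A)\,|A|\,|B|^2}{\tau^3}.$$ -/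

import Mathlib

/-- The additive symmetry set `Sym_t^+(Q, R) = {x : |Q ∩ (x - R)| ≥ t}`. -/
def symPlus (t : ℝ) (Q R : Finset ℝ) : Set ℝ :=
  {x : ℝ | t ≤ ((Q ∩ R.image (fun r => x - r)).card : ℝ)}

/-- The values `|Q|² |R|² / (|A| t³)`, over all real `t > 0` and all nonempty finite sets
`Q, R ⊆ ℝ \ {0}` with `A ⊆ Sym_t^+(Q, R)` and `max {|Q|, |R|} ≥ |A|`. -/
def dPlusValues (A : Finset ℝ) : Set ℝ :=
  {v : ℝ | ∃ (t : ℝ) (Q R : Finset ℝ), 0 < t ∧ Q.Nonempty ∧ R.Nonempty ∧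
    (0 : ℝ) ∉ Q ∧ (0 : ℝ) ∉ R ∧ (A : Set ℝ) ⊆ symPlus t Q R ∧ A.card ≤ max Q.card R.card ∧
    v = (Q.card : ℝ) ^ 2 * (R.card : ℝ) ^ 2 / ((A.card : ℝ) * t ^ 3)}

/-- The quantity `d_+(A)`, the least element of `dPlusValues A`
(for nonempty `A` it is attained, see `dPlus_isLeast`). -/
noncomputable def dPlus (A : Finset ℝ) : ℝ := sInf (dPlusValues A)

/-- The quotient set `A B⁻¹ = {a / b : a ∈ A, b ∈ B, b ≠ 0}`. -/
noncomputable def quotSet (A B : Finset ℝ) : Finset ℝ :=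
  (A ×ˢ B.filter (fun b => b ≠ 0)).image (fun p => p.1 / p.2)

/-- The set `{s ∈ A B⁻¹ : |A ∩ s B| ≥ τ}`. -/
noncomputable def richQuotients (A B : Finset ℝ) (τ : ℝ) : Finset ℝ :=
  (quotSet A B).filter (fun s => τ ≤ ((A ∩ B.image (fun b => s * b)).card : ℝ))

theorem dPlusValues_nonempty (A : Finset ℝ) (hA : A.Nonempty) : (dPlusValues A).Nonempty := by
  obtain ⟨x, hx⟩ := Infinite.exists_notMem_finset (insert 0 (A.image (fun a => -a)))
  have hx0 : x ≠ 0 := fun h => hx (by simp [h])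
  have hxA : ∀ a ∈ A, a + x ≠ 0 := fun a ha h =>
    hx (Finset.mem_insert_of_mem (Finset.mem_image.2 ⟨a, ha, by linarith⟩))
  have hc : (A.image (fun a => a + x)).card = A.card :=
    Finset.card_image_of_injective _ (add_left_injective x)
  refine ⟨_, 1, A.image (fun a => a + x), {-x}, one_pos, hA.image _, by simp, ?_, by simpa using hx0,
    ?_, by rw [hc]; exact le_max_left _ _, rfl⟩
  · intro h
    obtain ⟨a, ha, h0⟩ := Finset.mem_image.1 h
    exact hxA a ha h0
  · intro a ha
    have : 0 < (A.image (fun a => a + x) ∩ ({-x} : Finset ℝ).image (fun r => a - r)).card := by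
      refine Finset.card_pos.2 ⟨a + x, Finset.mem_inter.2 ⟨Finset.mem_image.2 ⟨a, ha, rfl⟩, ?_⟩⟩
      simp
    exact (Nat.one_le_cast (α := ℝ)).2 this

/-- For nonempty `A` the minimum that defines `d_+(A)` is attained. -/
theorem dPlus_isLeast (A : Finset ℝ) (hA : A.Nonempty) :
    IsLeast (dPlusValues A) (dPlus A) := by
  classical
  have hA0 : (0 : ℝ) < A.card := by exact_mod_cast hA.card_pos
  -- every value is dominated by a value with an integral `t ≤ |Q|, |R|`
  have key : ∀ v ∈ dPlusValues A, ∃ n q r : ℕ, n ≤ q ∧ n ≤ r ∧ 0 < n ∧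
      (q : ℝ) ^ 2 * (r : ℝ) ^ 2 / ((A.card : ℝ) * (n : ℝ) ^ 3) ∈ dPlusValues A ∧
      (q : ℝ) ^ 2 * (r : ℝ) ^ 2 / ((A.card : ℝ) * (n : ℝ) ^ 3) ≤ v := by
    rintro v ⟨t, Q, R, ht, hQ, hR, hQ0, hR0, hS, hm, rfl⟩
    have hS' : ∀ a ∈ A, ⌈t⌉₊ ≤ (Q ∩ R.image (fun r => a - r)).card :=
      fun a ha => Nat.ceil_le.2 (hS ha)
    obtain ⟨a, ha⟩ := hA
    have hpos : 0 < ⌈t⌉₊ := Nat.ceil_pos.2 ht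
    refine ⟨⌈t⌉₊, Q.card, R.card, (hS' a ha).trans (Finset.card_le_card Finset.inter_subset_left),
      (hS' a ha).trans ((Finset.card_le_card Finset.inter_subset_right).trans
        Finset.card_image_le), hpos,
      ⟨⌈t⌉₊, Q, R, by exact_mod_cast hpos, hQ, hR, hQ0, hR0, ?_, hm, rfl⟩, ?_⟩
    · intro b hb
      exact (Nat.cast_le (α := ℝ)).2 (hS' b hb)
    · have := Nat.le_ceil t
      gcongr
  obtain ⟨v₀, hv₀⟩ := dPlusValues_nonempty A hA
  -- the integral values up to `v₀` form a finite set
  set N : ℕ := ⌈v₀ * A.card⌉₊ with hN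
  set F : Set ℝ := dPlusValues A ∩
    (((Finset.range (N + 1) ×ˢ Finset.range (N + 1) ×ˢ Finset.range (N + 1)).image
      (fun p : ℕ × ℕ × ℕ => (p.2.1 : ℝ) ^ 2 * (p.2.2 : ℝ) ^ 2 / ((A.card : ℝ) * (p.1 : ℝ) ^ 3)) :
        Finset ℝ) : Set ℝ) with hF
  have hFfin : F.Finite := (Finset.finite_toSet _).inter_of_right _
  have key2 : ∀ v ∈ dPlusValues A, v ≤ v₀ → ∃ w ∈ F, w ≤ v := by
    intro v hv hvv
    obtain ⟨n, q, r, hnq, hnr, hn, hw, hwv⟩ := key v hv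
    have hb : (q : ℝ) ^ 2 * (r : ℝ) ^ 2 ≤ v₀ * A.card * (n : ℝ) ^ 3 := by
      have hn' : (0 : ℝ) < n := by exact_mod_cast hn
      have := (div_le_iff₀ (by positivity)).1 (hwv.trans hvv)
      linarith
    have hb' : q ^ 2 * r ^ 2 ≤ N * n ^ 3 := by
      have : (q : ℝ) ^ 2 * (r : ℝ) ^ 2 ≤ (N : ℝ) * (n : ℝ) ^ 3 :=
        hb.trans (mul_le_mul_of_nonneg_right (Nat.le_ceil _) (by positivity))
      exact_mod_cast this
    have hq : q ≤ N := by
      have h1 : q * n ^ 3 ≤ N * n ^ 3 := by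
        refine le_trans ?_ hb'
        calc q * n ^ 3 = q * n * n ^ 2 := by ring
          _ ≤ q * q * r ^ 2 := by gcongr
          _ = q ^ 2 * r ^ 2 := by ring
      exact Nat.le_of_mul_le_mul_right h1 (by positivity)
    have hr : r ≤ N := by
      have h1 : r * n ^ 3 ≤ N * n ^ 3 := by
        refine le_trans ?_ hb'
        calc r * n ^ 3 = n ^ 2 * (r * n) := by ring
          _ ≤ q ^ 2 * (r * r) := by gcongr
          _ = q ^ 2 * r ^ 2 := by ring
      exact Nat.le_of_mul_le_mul_right h1 (by positivity)
    refine ⟨_, ⟨hw, ?_⟩, hwv⟩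
    refine Finset.mem_coe.2 (Finset.mem_image.2 ⟨(n, q, r), ?_, rfl⟩)
    simp only [Finset.mem_product, Finset.mem_range]
    omega
  obtain ⟨w₀, hw₀, hwv₀⟩ := key2 v₀ hv₀ le_rfl
  obtain ⟨m, hm, hmin⟩ := Set.exists_min_image F id hFfin ⟨w₀, hw₀⟩
  have hleast : IsLeast (dPlusValues A) m := by
    refine ⟨hm.1, fun v hv => ?_⟩
    rcases le_total v v₀ with h | h
    · obtain ⟨w, hw, hwv⟩ := key2 v hv h
      exact (hmin w hw).trans hwv
    · exact ((hmin w₀ hw₀).trans hwv₀).trans h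
  rw [dPlus, hleast.csInf_eq]
  exact hleast

/-! Let `Q`, `R`, `t` attain `dPlus A`. If `s * b ∈ A`, then `s * b = q + r` in at least `t` ways,
and each puts the point `(s, r)` on the line `y = b x - q`. A rich `s` has at least `τ / 2` such
nonzero `b`, so `N` rich quotients yield at least `N t τ / 2` incidences with at most `|B| |Q|`
lines. Szemerédi–Trotter then bounds `N`; the size condition on `Q`, `R` handles its degenerate,
linear alternative.

For a grid, Szemerédi–Trotter follows from cutting both axes into blocks: a line of nonzero slope is
monotone, so it meets few cells, while two distinct points sharing a cell determine the line. -/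

/-! ### Cell decompositions -/

/-- A monotone map to `ℕ` that splits `X` into at most `|X| / u + 1` blocks of size at most `u`. -/
theorem exists_monotone_blocks (X : Finset ℝ) (u : ℕ) (hu : 0 < u) :
    ∃ f : ℝ → ℕ, Monotone f ∧ (∀ x, f x ≤ X.card / u) ∧
      ∀ k, (X.filter (fun x => f x = k)).card ≤ u := by
  have hmono : Monotone (fun x : ℝ => (X.filter (fun z => z < x)).card) := fun x y hxy =>
    Finset.card_le_card (Finset.monotone_filter_right _ (fun z _ hz => lt_of_lt_of_le hz hxy))
  -- The block index is the rank in `X` divided by `u`; ranks are distinct on `X`.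
  refine ⟨fun x => (X.filter (fun z => z < x)).card / u, ?_, ?_, ?_⟩
  · intro x y hxy
    exact Nat.div_le_div_right (hmono hxy)
  · intro x
    exact Nat.div_le_div_right (Finset.card_filter_le _ _)
  · intro k
    have hlt : ∀ x ∈ X, ∀ y, x < y →
        (X.filter (fun z => z < x)).card < (X.filter (fun z => z < y)).card := by
      intro x hx y hxy
      refine Finset.card_lt_card (Finset.ssubset_iff_of_subset
        (Finset.monotone_filter_right _ (fun z _ hz => lt_trans hz hxy)) |>.2 ⟨x, ?_, ?_⟩)
      · simp [hx, hxy]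
      · simp
    have h : (X.filter (fun x => (X.filter (fun z => z < x)).card / u = k)).card ≤
        (Finset.Ico (k * u) ((k + 1) * u)).card := by
      refine Finset.card_le_card_of_injOn (fun x => (X.filter (fun z => z < x)).card) ?_ ?_
      · intro x hx
        have hx' := (Finset.mem_filter.1 hx).2
        rw [Nat.div_eq_iff hu] at hx'
        simp only [Finset.coe_Ico, Set.mem_Ico]
        have : (k + 1) * u = k * u + u := by ring
        omega
      · intro x hx y hy hxy
        have hx' := (Finset.mem_filter.1 hx).1
        have hy' := (Finset.mem_filter.1 hy).1
        rcases lt_trichotomy x y with h | h | h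
        · exact absurd hxy (hlt x hx' y h).ne
        · exact h
        · exact absurd hxy (hlt y hy' x h).ne'
    have e : (k + 1) * u - k * u = u := by
      rw [← Nat.sub_mul]; simp
    rwa [Nat.card_Ico, e] at h

/-- A map from `T` to `N` colours has at least `|T| - N` ordered monochromatic pairs. -/
theorem card_le_add_card_offDiag_filter {α : Type*} [DecidableEq α] (T : Finset α) (F : α → ℕ)
    (N : ℕ) (hF : ∀ x ∈ T, F x < N) :
    T.card ≤ N + (T.offDiag.filter (fun p => F p.1 = F p.2)).card := by
  have h1 : T.card = ∑ k ∈ Finset.range N, (T.filter (fun x => F x = k)).card :=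
    Finset.card_eq_sum_card_fiberwise (fun x hx => by simpa using hF x hx)
  have h2 : (T.offDiag.filter (fun p => F p.1 = F p.2)).card =
      ∑ k ∈ Finset.range N, (T.filter (fun x => F x = k)).offDiag.card := by
    rw [Finset.card_eq_sum_card_fiberwise (f := fun p : α × α => F p.1) (t := Finset.range N)]
    · refine Finset.sum_congr rfl (fun k _ => congrArg _ ?_)
      ext p
      simp only [Finset.mem_filter, Finset.mem_offDiag]
      grind
    · intro p hp
      have := (Finset.mem_offDiag.1 (Finset.mem_filter.1 hp).1).1
      simpa using hF _ this
  rw [h1, h2]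
  calc _ ≤ ∑ k ∈ Finset.range N, (1 + (T.filter (fun x => F x = k)).offDiag.card) := by
        refine Finset.sum_le_sum (fun k _ => ?_)
        -- A colour class of size `n` satisfies `n ≤ 1 + n(n - 1)`.
        rw [Finset.offDiag_card]
        rcases Nat.lt_or_ge (T.filter (fun x => F x = k)).card 2 with h | h
        · omega
        · have := Nat.mul_le_mul_right (T.filter (fun x => F x = k)).card h
          omega
    _ = _ := by rw [Finset.sum_add_distrib]; simp

/-- The pairs of points of `X` that share a block. -/
theorem card_pairs_same_block (X : Finset ℝ) (f : ℝ → ℕ) (u : ℕ)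
    (hf : ∀ k, (X.filter (fun x => f x = k)).card ≤ u) :
    ((X ×ˢ X).filter (fun p => f p.1 = f p.2)).card ≤ X.card * u := by
  rw [Finset.card_filter, Finset.sum_product, ← smul_eq_mul, ← Finset.sum_const]
  refine Finset.sum_le_sum (fun x _ => ?_)
  rw [← Finset.card_filter]
  simpa only [eq_comm] using hf (f x)

/-! ### Incidences in Cartesian products -/

/-- The abscissae of the points of `X × Y` on the line `y = m x + c`, where `ℓ = (m, c)`. -/
noncomputable def lineAbscissae (X Y : Finset ℝ) (ℓ : ℝ × ℝ) : Finset ℝ :=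
  X.filter (fun x => ℓ.1 * x + ℓ.2 ∈ Y)

/-- On a line of nonzero slope, the points of `X × Y` number at most the crossed cells plus the
pairs that share a cell. -/
theorem card_lineAbscissae_le (X Y : Finset ℝ) (ℓ : ℝ × ℝ) (hℓ : ℓ.1 ≠ 0) (f g : ℝ → ℕ)
    (a b : ℕ) (hf : Monotone f) (hg : Monotone g) (hfa : ∀ x, f x ≤ a) (hgb : ∀ y, g y ≤ b) :
    (lineAbscissae X Y ℓ).card ≤ (a + b + 1) + ((lineAbscissae X Y ℓ).offDiag.filter
      (fun p => f p.1 = f p.2 ∧ g (ℓ.1 * p.1 + ℓ.2) = g (ℓ.1 * p.2 + ℓ.2))).card := by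
  -- `h` indexes the horizontal strips along the line, in reverse order when the slope is negative,
  -- so that it increases with `x`.
  have key : ∃ h : ℝ → ℕ, Monotone h ∧ (∀ x, h x ≤ b) ∧
      ∀ x y, h x = h y → g (ℓ.1 * x + ℓ.2) = g (ℓ.1 * y + ℓ.2) := by
    rcases lt_or_gt_of_ne hℓ with h | h
    · refine ⟨fun x => b - g (ℓ.1 * x + ℓ.2), ?_, fun x => Nat.sub_le _ _, ?_⟩
      · intro x y hxy
        exact Nat.sub_le_sub_left (hg (by nlinarith)) _
      · intro x y hxy
        have h1 := hgb (ℓ.1 * x + ℓ.2)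
        have h2 := hgb (ℓ.1 * y + ℓ.2)
        simp only at hxy
        omega
    · exact ⟨fun x => g (ℓ.1 * x + ℓ.2), fun x y hxy => hg (by nlinarith), fun x => hgb _,
        fun x y hxy => hxy⟩
  obtain ⟨h, hmono, hb, hh⟩ := key
  -- The colour `f + h` takes at most `a + b + 1` values. As both summands are monotone, equal sums
  -- force equal summands, that is, the same cell.
  refine (card_le_add_card_offDiag_filter (lineAbscissae X Y ℓ) (fun x => f x + h x) (a + b + 1)
    (fun x _ => by have := hfa x; have := hb x; omega)).trans ?_
  refine Nat.add_le_add_left (Finset.card_le_card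
    (Finset.monotone_filter_right _ (fun p _ hp => ?_))) _
  have hp' : f p.1 + h p.1 = f p.2 + h p.2 := hp
  have : f p.1 = f p.2 ∧ h p.1 = h p.2 := by
    rcases le_total p.1 p.2 with h' | h'
    · have := hf h'; have := hmono h'; omega
    · have := hf h'; have := hmono h'; omega
  exact ⟨this.1, hh _ _ this.2⟩

/-- Incidence bound for a Cartesian product cut into cells of size at most `u × v`. -/
theorem sum_card_lineAbscissae_le (X Y : Finset ℝ) (L : Finset (ℝ × ℝ))
    (hL : ∀ ℓ ∈ L, ℓ.1 ≠ 0) (u v : ℕ) (hu : 0 < u) (hv : 0 < v) :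
    ∑ ℓ ∈ L, (lineAbscissae X Y ℓ).card ≤
      L.card * (X.card / u + Y.card / v + 1) + X.card * u * (Y.card * v) := by
  obtain ⟨f, hf, hfa, hfu⟩ := exists_monotone_blocks X u hu
  obtain ⟨g, hg, hgb, hgv⟩ := exists_monotone_blocks Y v hv
  refine (Finset.sum_le_sum (fun ℓ hℓ =>
    card_lineAbscissae_le X Y ℓ (hL ℓ hℓ) f g _ _ hf hg hfa hgb)).trans ?_
  rw [Finset.sum_add_distrib, Finset.sum_const, smul_eq_mul]
  refine Nat.add_le_add_left ?_ _
  rw [← Finset.card_sigma]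
  refine le_trans ?_ (Nat.mul_le_mul (card_pairs_same_block X f u hfu)
    (card_pairs_same_block Y g v hgv))
  rw [← Finset.card_product]
  -- Two points with distinct abscissae determine the line, so no pair is counted for two lines.
  refine Finset.card_le_card_of_injOn
    (fun s => (s.2, (s.1.1 * s.2.1 + s.1.2, s.1.1 * s.2.2 + s.1.2))) ?_ ?_
  · rintro ⟨ℓ, x, x'⟩ hs
    simp only [Finset.coe_sigma, Set.mem_sigma_iff, Finset.mem_coe, Finset.mem_filter,
      Finset.mem_offDiag, lineAbscissae, Finset.mem_product] at hs ⊢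
    tauto
  · rintro ⟨⟨m, c⟩, x, x'⟩ hs ⟨⟨m', c'⟩, z, z'⟩ hs' heq
    simp only [Finset.coe_sigma, Set.mem_sigma_iff, Finset.mem_coe, Finset.mem_filter,
      Finset.mem_offDiag] at hs hs'
    simp only [Prod.mk.injEq] at heq
    obtain ⟨⟨rfl, rfl⟩, h1, h2⟩ := heq
    have hne : x - x' ≠ 0 := sub_ne_zero.2 hs.2.1.2.2
    have hm : m = m' := mul_right_cancel₀ hne (by linarith)
    subst hm
    have hc : c = c' := by linarith
    subst hc
    rfl

theorem card_lineAbscissae_le_right (X Y : Finset ℝ) (ℓ : ℝ × ℝ) (hℓ : ℓ.1 ≠ 0) :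
    (lineAbscissae X Y ℓ).card ≤ Y.card := by
  refine Finset.card_le_card_of_injOn (fun x => ℓ.1 * x + ℓ.2)
    (fun x hx => (Finset.mem_filter.1 hx).2) (fun x _ y _ hxy => ?_)
  exact mul_left_cancel₀ hℓ (add_right_cancel hxy)

/-- Rounding `x / lam ≥ 1` down to an integer loses at most a factor of 2. -/
theorem exists_nat_div_le {x lam : ℝ} (hlam : 0 < lam) (h : lam ≤ x) :
    ∃ u : ℕ, 0 < u ∧ x / u ≤ 2 * lam ∧ (u : ℝ) ≤ x / lam := by
  have h1 : 1 ≤ x / lam := (one_le_div hlam).2 h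
  have hu : 0 < ⌊x / lam⌋₊ := Nat.floor_pos.2 h1
  refine ⟨⌊x / lam⌋₊, hu, ?_, Nat.floor_le (by linarith)⟩
  have hu' : (1 : ℝ) ≤ ⌊x / lam⌋₊ := by exact_mod_cast hu
  have h2 := Nat.lt_floor_add_one (x / lam)
  have h3 : x / lam ≤ 2 * ⌊x / lam⌋₊ := by linarith
  rw [div_le_iff₀ hlam] at h3
  rw [div_le_iff₀ (by linarith)]
  linarith

/-- The Szemerédi–Trotter theorem for Cartesian products and lines of nonzero slope. -/
theorem szemeredi_trotter_cartesian (X Y : Finset ℝ) (L : Finset (ℝ × ℝ))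
    (hL : ∀ ℓ ∈ L, ℓ.1 ≠ 0) :
    ((∑ ℓ ∈ L, (lineAbscissae X Y ℓ).card : ℕ) : ℝ) ^ 3 ≤
        216 * ((X.card : ℝ) * Y.card * L.card) ^ 2 ∨
      ((∑ ℓ ∈ L, (lineAbscissae X Y ℓ).card : ℕ) : ℝ) ≤ 4 * L.card := by
  have hIX : ((∑ ℓ ∈ L, (lineAbscissae X Y ℓ).card : ℕ) : ℝ) ≤ L.card * X.card := by
    exact_mod_cast Finset.sum_le_card_nsmul L _ X.card (fun ℓ _ => Finset.card_filter_le _ _)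
  have hIY : ((∑ ℓ ∈ L, (lineAbscissae X Y ℓ).card : ℕ) : ℝ) ≤ L.card * Y.card := by
    exact_mod_cast Finset.sum_le_card_nsmul L _ Y.card
      (fun ℓ hℓ => card_lineAbscissae_le_right X Y ℓ (hL ℓ hℓ))
  have hcell : ∀ u v : ℕ, 0 < u → 0 < v →
      ((∑ ℓ ∈ L, (lineAbscissae X Y ℓ).card : ℕ) : ℝ) ≤
        L.card * ((X.card : ℝ) / u + Y.card / v + 1) + X.card * u * (Y.card * v) := by
    intro u v hu hv
    have h : ((∑ ℓ ∈ L, (lineAbscissae X Y ℓ).card : ℕ) : ℝ) ≤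
        ((L.card * (X.card / u + Y.card / v + 1) + X.card * u * (Y.card * v) : ℕ) : ℝ) := by
      exact_mod_cast sum_card_lineAbscissae_le X Y L hL u v hu hv
    refine h.trans ?_
    push_cast
    gcongr
    · exact Nat.cast_div_le
    · exact Nat.cast_div_le
  generalize ((∑ ℓ ∈ L, (lineAbscissae X Y ℓ).card : ℕ) : ℝ) = I at *
  rcases Nat.eq_zero_or_pos L.card with hl | hl
  · right; simp [hl] at hIX ⊢; linarith
  rcases Nat.eq_zero_or_pos X.card with hx | hx
  · right; simp [hx] at hIX; have : (0 : ℝ) ≤ L.card := by positivity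
    linarith
  rcases Nat.eq_zero_or_pos Y.card with hy | hy
  · right; simp [hy] at hIY; have : (0 : ℝ) ≤ L.card := by positivity
    linarith
  have hx' : (0 : ℝ) < X.card := by exact_mod_cast hx
  have hy' : (0 : ℝ) < Y.card := by exact_mod_cast hy
  have hl' : (0 : ℝ) < L.card := by exact_mod_cast hl
  rcases le_total I 0 with hI | hI
  · right; linarith
  have hcellmax := hcell X.card Y.card hx hy
  generalize (X.card : ℝ) = x at *
  generalize (Y.card : ℝ) = y at *
  generalize (L.card : ℝ) = l at *
  -- With about `lam` blocks per axis, this value balances the crossing term `l * lam` against the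
  -- pair term `x² y² / lam²`.
  obtain ⟨lam, hlam, hlam3⟩ : ∃ lam : ℝ, 0 < lam ∧ lam ^ 3 * l = x ^ 2 * y ^ 2 := by
    refine ⟨(x ^ 2 * y ^ 2 / l) ^ ((1 : ℝ) / 3), by positivity, ?_⟩
    rw [← Real.rpow_natCast, ← Real.rpow_mul (by positivity)]
    norm_num
    field_simp
  rcases le_total lam 1 with h1 | h1
  · right
    have : lam ^ 3 ≤ 1 := pow_le_one₀ hlam.le h1
    rw [div_self hx'.ne', div_self hy'.ne'] at hcellmax
    nlinarith
  left
  -- Blocks would have size below 1 here; the trivial bound `I ≤ l * x` suffices.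
  rcases le_total x lam with h2 | h2
  · have h3 : x ^ 3 ≤ lam ^ 3 := by gcongr
    calc I ^ 3 ≤ (l * x) ^ 3 := by gcongr
      _ = l ^ 2 * (x ^ 3 * l) := by ring
      _ ≤ l ^ 2 * (lam ^ 3 * l) := by gcongr
      _ = 1 * (x * y * l) ^ 2 := by rw [hlam3]; ring
      _ ≤ _ := by gcongr; norm_num
  rcases le_total y lam with h3 | h3
  · have h3 : y ^ 3 ≤ lam ^ 3 := by gcongr
    calc I ^ 3 ≤ (l * y) ^ 3 := by gcongr
      _ = l ^ 2 * (y ^ 3 * l) := by ring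
      _ ≤ l ^ 2 * (lam ^ 3 * l) := by gcongr
      _ = 1 * (x * y * l) ^ 2 := by rw [hlam3]; ring
      _ ≤ _ := by gcongr; norm_num
  obtain ⟨u, hu, hu1, hu2⟩ := exists_nat_div_le hlam h2
  obtain ⟨v, hv, hv1, hv2⟩ := exists_nat_div_le hlam h3
  have hI6 : I ≤ 6 * l * lam := by
    calc I ≤ l * (x / u + y / v + 1) + x * u * (y * v) := hcell u v hu hv
      _ ≤ l * (2 * lam + 2 * lam + lam) + x * (x / lam) * (y * (y / lam)) := by gcongr
      _ = 5 * l * lam + (x ^ 2 * y ^ 2) / lam ^ 2 := by field_simp; ring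
      _ = 6 * l * lam := by rw [← hlam3]; field_simp; ring
  calc I ^ 3 ≤ (6 * l * lam) ^ 3 := by gcongr
    _ = 216 * l ^ 2 * (lam ^ 3 * l) := by ring
    _ = _ := by rw [hlam3]; ring

/-! ### Rich quotients as incidences -/

/-- If `s ∈ A B⁻¹` is `τ`-rich, then `s b ∈ A` for at least `τ / 2` nonzero `b ∈ B`. -/
theorem half_le_card_filter_of_mem_richQuotients {A B : Finset ℝ} {τ s : ℝ}
    (hs : s ∈ richQuotients A B τ) :
    τ / 2 ≤ ((B.filter (fun b => b ≠ 0 ∧ s * b ∈ A)).card : ℝ) := by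
  obtain ⟨hq, hτ⟩ := Finset.mem_filter.1 hs
  obtain ⟨⟨a, b⟩, hab, rfl⟩ := Finset.mem_image.1 hq
  simp only [Finset.mem_product, Finset.mem_filter] at hab
  obtain ⟨ha, hb, hb0⟩ := hab
  set s := a / b with hsdef
  -- Dropping `b = 0` loses at most one element, and one nonzero `b` always remains: `max 1 (τ - 1)
  -- ≥ τ / 2`.
  have h1 : 1 ≤ (B.filter (fun b => b ≠ 0 ∧ s * b ∈ A)).card := by
    refine Finset.card_pos.2 ⟨b, Finset.mem_filter.2 ⟨hb, hb0, ?_⟩⟩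
    rwa [hsdef, div_mul_cancel₀ _ hb0]
  have h2 : (A ∩ B.image (fun b => s * b)).card ≤
      (B.filter (fun b => b ≠ 0 ∧ s * b ∈ A)).card + 1 := by
    have hsub : A ∩ B.image (fun b => s * b) ⊆
        insert 0 ((B.filter (fun b => b ≠ 0 ∧ s * b ∈ A)).image (fun b => s * b)) := by
      intro x hx
      obtain ⟨hxA, hxB⟩ := Finset.mem_inter.1 hx
      obtain ⟨b', hb', rfl⟩ := Finset.mem_image.1 hxB
      by_cases h0 : b' = 0
      · simp [h0]
      · exact Finset.mem_insert_of_mem (Finset.mem_image.2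
          ⟨b', Finset.mem_filter.2 ⟨hb', h0, hxA⟩, rfl⟩)
    exact (Finset.card_le_card hsub).trans ((Finset.card_insert_le _ _).trans
      (Nat.add_le_add_right Finset.card_image_le 1))
  have h1' : (1 : ℝ) ≤ ((B.filter (fun b => b ≠ 0 ∧ s * b ∈ A)).card : ℝ) := by exact_mod_cast h1
  have h2' : ((A ∩ B.image (fun b => s * b)).card : ℝ) ≤
      ((B.filter (fun b => b ≠ 0 ∧ s * b ∈ A)).card : ℝ) + 1 := by exact_mod_cast h2
  linarith

/-- The lines `y = b x - q` with `b ∈ B` nonzero and `q ∈ Q`. -/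
noncomputable def translateLines (B Q : Finset ℝ) : Finset (ℝ × ℝ) :=
  B.filter (fun b => b ≠ 0) ×ˢ Q.image (fun q => -q)

theorem card_translateLines_le (B Q : Finset ℝ) :
    (translateLines B Q).card ≤ B.card * Q.card := by
  rw [translateLines, Finset.card_product]
  exact Nat.mul_le_mul (Finset.card_filter_le _ _) Finset.card_image_le

/-- Each rich quotient `s` gives many points `(s, r)` on the lines `y = b x - q`. -/
theorem card_richQuotients_mul_le {A B Q R : Finset ℝ} {t τ : ℝ} (ht : 0 < t)
    (hA : (A : Set ℝ) ⊆ symPlus t Q R) :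
    ((richQuotients A B τ).card : ℝ) * (t * τ / 2) ≤
      ((∑ ℓ ∈ translateLines B Q, (lineAbscissae (richQuotients A B τ) R ℓ).card : ℕ) : ℝ) := by
  have hswap : (∑ ℓ ∈ translateLines B Q, (lineAbscissae (richQuotients A B τ) R ℓ).card) =
      ∑ s ∈ richQuotients A B τ,
        ((translateLines B Q).filter (fun ℓ => ℓ.1 * s + ℓ.2 ∈ R)).card := by
    simp only [lineAbscissae, Finset.card_filter]
    exact Finset.sum_comm
  rw [hswap, ← nsmul_eq_mul]
  push_cast
  refine Finset.card_nsmul_le_sum _ _ _ (fun s hs => ?_)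
  have hτ := half_le_card_filter_of_mem_richQuotients hs
  have hcount : ∀ b ∈ B.filter (fun b => b ≠ 0 ∧ s * b ∈ A),
      t ≤ ((Q.filter (fun q => b * s - q ∈ R)).card : ℝ) := by
    intro b hb
    have hb' := (Finset.mem_filter.1 hb).2.2
    have h : t ≤ ((Q ∩ R.image (fun r => s * b - r)).card : ℝ) := hA hb'
    refine h.trans (Nat.cast_le.2 (Finset.card_le_card (fun q hq => ?_)))
    obtain ⟨hqQ, hqR⟩ := Finset.mem_inter.1 hq
    obtain ⟨r, hr, rfl⟩ := Finset.mem_image.1 hqR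
    refine Finset.mem_filter.2 ⟨hqQ, ?_⟩
    have : b * s - (s * b - r) = r := by ring
    rwa [this]
  have hinj : ((B.filter (fun b => b ≠ 0 ∧ s * b ∈ A)).sigma
      (fun b => Q.filter (fun q => b * s - q ∈ R))).card ≤
      ((translateLines B Q).filter (fun ℓ => ℓ.1 * s + ℓ.2 ∈ R)).card := by
    refine Finset.card_le_card_of_injOn (fun p => (p.1, -p.2)) ?_ ?_
    · rintro ⟨b, q⟩ hp
      simp only [Finset.coe_sigma, Set.mem_sigma_iff, Finset.mem_coe, Finset.mem_filter,
        translateLines, Finset.mem_product, Finset.mem_image] at hp ⊢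
      exact ⟨⟨⟨hp.1.1, hp.1.2.1⟩, q, hp.2.1, rfl⟩, by simpa [sub_eq_add_neg] using hp.2.2⟩
    · rintro ⟨b, q⟩ _ ⟨b', q'⟩ _ h
      simp only [Prod.mk.injEq, neg_inj] at h
      obtain ⟨rfl, rfl⟩ := h
      rfl
  calc t * τ / 2 = τ / 2 * t := by ring
    _ ≤ ((B.filter (fun b => b ≠ 0 ∧ s * b ∈ A)).card : ℝ) * t := by gcongr
    _ ≤ ∑ b ∈ B.filter (fun b => b ≠ 0 ∧ s * b ∈ A),
        ((Q.filter (fun q => b * s - q ∈ R)).card : ℝ) := by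
      rw [← nsmul_eq_mul]
      exact Finset.card_nsmul_le_sum _ _ _ hcount
    _ = (((B.filter (fun b => b ≠ 0 ∧ s * b ∈ A)).sigma
      (fun b => Q.filter (fun q => b * s - q ∈ R))).card : ℝ) := by
      rw [Finset.card_sigma]; push_cast; rfl
    _ ≤ _ := by exact_mod_cast hinj

theorem lemma16 :
    ∃ C : ℝ, 0 < C ∧ ∀ (A B : Finset ℝ) (τ : ℝ), 1 ≤ τ →
      ((richQuotients A B τ).card : ℝ) ≤
        C * (dPlus A * (A.card : ℝ) * (B.card : ℝ) ^ 2 / τ ^ 3) := by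
  -- `1728 = 216 * 2 ^ 3`, the cube coming from the halved richness.
  refine ⟨1728, by norm_num, fun A B τ hτ => ?_⟩
  have hτ0 : 0 < τ := by linarith
  rcases A.eq_empty_or_nonempty with rfl | hA
  · simp [richQuotients, quotSet]
  obtain ⟨t, Q, R, ht, -, -, -, -, hS, hmax, hd⟩ := (dPlus_isLeast A hA).1
  have hA0 : (0 : ℝ) < A.card := by exact_mod_cast hA.card_pos
  have hrhs : dPlus A * (A.card : ℝ) * (B.card : ℝ) ^ 2 / τ ^ 3 =
      ((Q.card : ℝ) * R.card * B.card) ^ 2 / (t * τ) ^ 3 := by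
    rw [hd]
    field_simp
  rw [hrhs, mul_div_assoc', le_div_iff₀ (by positivity)]
  rcases (richQuotients A B τ).eq_empty_or_nonempty with he | ⟨s, hs⟩
  · rw [he]
    simp only [Finset.card_empty, Nat.cast_zero, zero_mul]
    positivity
  have hτAB : τ ≤ ((A ∩ B.image (fun b => s * b)).card : ℝ) := (Finset.mem_filter.1 hs).2
  have hτA : τ ≤ A.card :=
    hτAB.trans (Nat.cast_le.2 (Finset.card_le_card Finset.inter_subset_left))
  have hτB : τ ≤ B.card := hτAB.trans (Nat.cast_le.2
    ((Finset.card_le_card Finset.inter_subset_right).trans Finset.card_image_le))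
  obtain ⟨a, ha⟩ := hA
  have htQR : t ≤ ((Q ∩ R.image (fun r => a - r)).card : ℝ) := hS ha
  have htQ : t ≤ Q.card :=
    htQR.trans (Nat.cast_le.2 (Finset.card_le_card Finset.inter_subset_left))
  have htR : t ≤ R.card := htQR.trans (Nat.cast_le.2
    ((Finset.card_le_card Finset.inter_subset_right).trans Finset.card_image_le))
  -- This is where `max {|Q|, |R|} ≥ |A|` enters: with `τ ≤ |A|`, it lets `τ` be traded for `|Q|` or
  -- `|R|`.
  have hsize : (t * τ) ^ 2 ≤ (Q.card : ℝ) * R.card ^ 2 * B.card := by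
    rcases le_max_iff.1 hmax with h | h
    · have hτQ : τ ≤ Q.card := hτA.trans (Nat.cast_le.2 h)
      calc (t * τ) ^ 2 = τ * t ^ 2 * τ := by ring
        _ ≤ _ := by gcongr
    · have hτR : τ ≤ R.card := hτA.trans (Nat.cast_le.2 h)
      calc (t * τ) ^ 2 = t * (t * τ) * τ := by ring
        _ ≤ (Q.card : ℝ) * (R.card * R.card) * B.card := by gcongr
        _ = _ := by ring
  have hlow := card_richQuotients_mul_le (B := B) (τ := τ) ht hS
  have hL : ((translateLines B Q).card : ℝ) ≤ B.card * Q.card := by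
    exact_mod_cast card_translateLines_le B Q
  have hN : (0 : ℝ) < (richQuotients A B τ).card := by
    exact_mod_cast Finset.card_pos.2 ⟨s, hs⟩
  rcases szemeredi_trotter_cartesian (richQuotients A B τ) R (translateLines B Q)
    (fun ℓ hℓ => (Finset.mem_filter.1 (Finset.mem_product.1 hℓ).1).2) with h | h
  · have h1 : (((richQuotients A B τ).card : ℝ) * (t * τ / 2)) ^ 3 ≤
        216 * (((richQuotients A B τ).card : ℝ) * R.card * (B.card * Q.card)) ^ 2 := by
      refine le_trans (by gcongr) (h.trans ?_)
      gcongr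
    refine le_of_mul_le_mul_left ?_ (pow_pos hN 2)
    linarith
  · have h1 : ((richQuotients A B τ).card : ℝ) * (t * τ) ≤ 8 * (B.card * Q.card) := by linarith
    calc ((richQuotients A B τ).card : ℝ) * (t * τ) ^ 3
        = ((richQuotients A B τ).card : ℝ) * (t * τ) * (t * τ) ^ 2 := by ring
      _ ≤ 8 * (B.card * Q.card) * ((Q.card : ℝ) * R.card ^ 2 * B.card) := by gcongr
      _ = 8 * ((Q.card : ℝ) * R.card * B.card) ^ 2 := by ring
      _ ≤ _ := by gcongr; norm_num
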